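/- All formulas are first-order formulas without parameters, and equivalence is modulo a theory $T$. For $n\ge 1$, an *$n$-formula* of $T$ is a formula that is $T$-equivalent to a Boolean combination of formulas each having at most $n$ free variables. A finite set $\Phi=\{\varphi_1(\bar x),\dots,\varphi_m(\bar x)\}$ of formulas in a common tuple of variables $\bar x$ (some of which may be dummy) *witnesses that $T$ is almost $n$-ary* if every formula is $T$-equivalent to a Boolean combination of $n$-formulas and of formulas obtained from $\varphi_1,\dots,\varphi_m$ by substituting (not necessarily distinct) variables for the variables $\bar x$. The theory $T$ is *almost $n$-ary* if such a finite set exists, and ${\rm aar}(T)$ is the least $n\ge 1$ such that $T$ is almost $n$-ary ($\infty$ if there is none). If ${\rm aar}(T)=n$ is finite, the *aar-degree* ${\rm deg}_{\rm aar}(T)$ is the pair $(m,r)$, where $r$ is the least length of a tuple $\bar x$ in which some finite set of formulas witnesses that $T$ is almost $n$-ary, and $m$ is the least number of formulas in such a witnessing set with $\bar x$ of length $r$; in particular it is $(0,0)$ if every formula is an $n$-formula. A pair $(m,r)$ of natural numbers is *admissible* (for $n$) if $(m,r)=(0,0)$, or $m\ge 1$ and $r>n$. **Theorem.** For every natural number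 $n\geq 2$ and every pair $(m,r)$ that is admissible for $n$ there is a (complete, consistent) first-order theory $T$ with ${\rm aar}(T)=n$ and ${\rm deg}_{\rm aar}(T)=(m,r)$. -/

import Mathlib

universe u v

/-- `IsBoolComb S φ`: the formula `φ` is a Boolean combination of formulas belonging to `S`. -/
inductive IsBoolComb {L : FirstOrder.Language.{u, v}} {α : Type} (S : Set (L.Formula α)) :
    L.Formula α → Prop
  | basic {φ : L.Formula α} : φ ∈ S → IsBoolComb S φ
  | bot : IsBoolComb S ⊥
  | not {φ : L.Formula α} : IsBoolComb S φ → IsBoolComb S φ.not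
  | inf {φ ψ : L.Formula α} : IsBoolComb S φ → IsBoolComb S ψ → IsBoolComb S (φ ⊓ ψ)
  | sup {φ ψ : L.Formula α} : IsBoolComb S φ → IsBoolComb S ψ → IsBoolComb S (φ ⊔ ψ)

/-- The formulas, in the variables `x₀, x₁, …`, obtained from the formulas `φ(y₀, …, y_{l-1})` of
`Φ` by substituting variables (not necessarily distinct) for the free variables `y₀, …, y_{l-1}`. -/
def substInstances {L : FirstOrder.Language.{u, v}} {l : ℕ} (Φ : Set (L.Formula (Fin l))) :
    Set (L.Formula ℕ) :=
  {χ | ∃ φ ∈ Φ, ∃ g : Fin l → ℕ, χ = φ.relabel g}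

/-- `φ` is an `n`-formula of `T`: it is `T`-equivalent to a Boolean combination of formulas each
of which has (at most) `n` free variables. -/
def IsNFormula {L : FirstOrder.Language.{u, v}} (T : L.Theory) (n : ℕ) (φ : L.Formula ℕ) : Prop :=
  ∃ ψ : L.Formula ℕ,
    IsBoolComb (substInstances (Set.univ : Set (L.Formula (Fin n)))) ψ ∧ T.Iff φ ψ

/-- The finite set `Φ` of formulas `φ(y₀, …, y_{l-1})` witnesses that `T` is almost `n`-ary:
every formula is `T`-equivalent to a Boolean combination of `n`-formulas and of formulas obtained
from members of `Φ` by substitutions of free variables. -/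
def WitnessesAlmostAry {L : FirstOrder.Language.{u, v}} (T : L.Theory) (n : ℕ) {l : ℕ}
    (Φ : Finset (L.Formula (Fin l))) : Prop :=
  ∀ φ : L.Formula ℕ, ∃ ψ : L.Formula ℕ,
    IsBoolComb ({χ | IsNFormula T n χ} ∪ substInstances (Φ : Set (L.Formula (Fin l)))) ψ ∧
      T.Iff φ ψ

/-- `T` is almost `n`-ary. -/
def AlmostAry {L : FirstOrder.Language.{u, v}} (T : L.Theory) (n : ℕ) : Prop :=
  ∃ (l : ℕ) (Φ : Finset (L.Formula (Fin l))), WitnessesAlmostAry T n Φ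

/-- `aar(T)`: the least `n ≥ 1` such that `T` is almost `n`-ary, and `∞` if there is none. -/
noncomputable def aar {L : FirstOrder.Language.{u, v}} (T : L.Theory) : ℕ∞ :=
  sInf {N : ℕ∞ | ∃ n : ℕ, N = n ∧ 1 ≤ n ∧ AlmostAry T n}

/-- The aar-degree of `T` is `(m, r)`: with `n = aar(T)` finite, `r` is the least length of a
tuple of variables in which some finite set of formulas witnesses that `T` is almost `n`-ary, and
`m` is the least cardinality of such a witnessing set of formulas in `r` variables. (If `T` is
`n`-ary, the empty set is a witness, and the degree is `(0, 0)`.) -/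
def HasAarDegree {L : FirstOrder.Language.{u, v}} (T : L.Theory) (m r : ℕ) : Prop :=
  ∃ n : ℕ, aar T = n ∧
    IsLeast {l : ℕ | ∃ Φ : Finset (L.Formula (Fin l)), WitnessesAlmostAry T n Φ} r ∧
    IsLeast {k : ℕ | ∃ Φ : Finset (L.Formula (Fin r)),
      Φ.card = k ∧ WitnessesAlmostAry T n Φ} m

/-- The pairs that are admissible as aar-degrees of theories `T` with `aar(T) = n`. -/
def IsAdmissiblePair (n m r : ℕ) : Prop :=
  (m = 0 ∧ r = 0) ∨ (m ≠ 0 ∧ n < r)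

/-!
`T` is the theory of a generic structure carrying infinitely many `n`-uniform hypergraphs and `m`
further `r`-uniform ones. A back-and-forth argument eliminates quantifiers, so the `m` edge formulas
of arity `r` witness that `T` is almost `n`-ary.

The lower bounds come from simplices: sets of `k` points no proper subset of which is an edge, and
which form an edge of an arbitrarily prescribed finite subfamily of the `k`-uniform hypergraphs.
Fewer than `k` points of a simplex carry no information about that subfamily. Hence for `k = n` a
finite set of formulas, which mentions only finitely many of the `n`-uniform hypergraphs, does not
make `T` almost `(n - 1)`-ary; for `k = r` a witnessing set needs at least `r` variables; and a
witnessing set in `r` variables has to tell apart `2 ^ m` kinds of `r`-point simplices by the truth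
values of its members, each of which is symmetric on a simplex, so it has at least `m` elements.
-/

open FirstOrder FirstOrder.Language FirstOrder.Language.Structure

section CompleteTheory

variable {L : FirstOrder.Language.{u, v}} {α : Type*} {M : Type*} [L.Structure M] [Nonempty M]

theorem realize_exClosure_iff_exists_realize [DecidableEq α] (φ : L.Formula α) :
    M ⊨ φ.exClosure ↔ ∃ v : α → M, φ.Realize v := by
  rw [← Formula.exists_realize_equivSentence_iff_realize_exClosure]
  refine exists_congr fun v => ?_
  simpa using (Formula.realize_equivSentence_symm M (Formula.equivSentence φ) v).symm

theorem completeTheory_models_iff (φ : L.Formula α) :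
    L.completeTheory M ⊨ᵇ φ ↔ ∀ v : α → M, φ.Realize v := by
  classical
  refine ⟨fun h v => h.realize_formula M, fun h => Theory.models_formula_iff.2 fun N v => ?_⟩
  by_contra hv
  have hN : N ⊨ φ.not.exClosure := (realize_exClosure_iff_exists_realize _).2 ⟨v, hv⟩
  rw [realize_iff_of_model_completeTheory M N, realize_exClosure_iff_exists_realize] at hN
  obtain ⟨w, hw⟩ := hN
  exact hw (h w)

theorem completeTheory_iff_iff (φ ψ : L.Formula α) :
    (L.completeTheory M).Iff φ ψ ↔ ∀ v : α → M, φ.Realize v ↔ ψ.Realize v :=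
  (completeTheory_models_iff (φ.iff ψ)).trans <| forall_congr' fun _ => Formula.realize_iff

end CompleteTheory

section BooleanCombinations

variable {L : FirstOrder.Language.{u, v}} {α : Type} {S : Set (L.Formula α)}
  {M : Type*} [L.Structure M] {κ : Type*} [Finite κ]

namespace IsBoolComb

theorem realize_iff {ψ : L.Formula α} (hψ : IsBoolComb S ψ) {v w : α → M}
    (h : ∀ χ ∈ S, χ.Realize v ↔ χ.Realize w) : ψ.Realize v ↔ ψ.Realize w := by
  induction hψ with
  | basic hχ => exact h _ hχ
  | bot => rfl
  | not _ ih => rw [Formula.realize_not, Formula.realize_not, ih]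
  | inf _ _ ih₁ ih₂ => rw [Formula.realize_inf, Formula.realize_inf, ih₁, ih₂]
  | sup _ _ ih₁ ih₂ => rw [Formula.realize_sup, Formula.realize_sup, ih₁, ih₂]

theorem iSup {φ : κ → L.Formula α} (h : ∀ k, IsBoolComb S (φ k)) :
    IsBoolComb S (Formula.iSup φ) := by
  have foldr_sup (ks : List κ) : IsBoolComb S ((ks.map φ).foldr (· ⊔ ·) ⊥) := by
    induction ks with
    | nil => exact .bot
    | cons k _ ih => exact .sup (h k) ih
  exact foldr_sup _

theorem iInf {φ : κ → L.Formula α} (h : ∀ k, IsBoolComb S (φ k)) :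
    IsBoolComb S (Formula.iInf φ) := by
  have foldr_inf (ks : List κ) : IsBoolComb S ((ks.map φ).foldr (· ⊓ ·) ⊤) := by
    induction ks with
    | nil => exact .not .bot
    | cons k _ ih => exact .inf (h k) ih
  exact foldr_inf _

end IsBoolComb

theorem exists_isBoolComb_realize_iff {θ : κ → L.Formula α} (hθ : ∀ k, θ k ∈ S)
    {P : (α → M) → Prop}
    (hP : ∀ v w, (∀ k, (θ k).Realize v ↔ (θ k).Realize w) → (P v ↔ P w)) :
    ∃ ψ : L.Formula α, IsBoolComb S ψ ∧ ∀ v, ψ.Realize v ↔ P v := by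
  classical
  -- Disjunctive normal form, with one disjunct for each truth pattern of `θ` realized in `P`.
  let Pattern := {p : κ → Prop // ∃ v, P v ∧ ∀ k, (θ k).Realize v ↔ p k}
  let literal (p : Pattern) (k : κ) : L.Formula α := if p.1 k then θ k else (θ k).not
  have hliteral (p : Pattern) (k : κ) (v : α → M) :
      (literal p k).Realize v ↔ ((θ k).Realize v ↔ p.1 k) := by
    by_cases hk : p.1 k <;> simp [literal, hk]
  refine ⟨Formula.iSup fun p => Formula.iInf (literal p), .iSup fun p => .iInf fun k => ?_,
    fun v => ?_⟩
  · by_cases hk : p.1 k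
    · simpa only [literal, if_pos hk] using .basic (hθ k)
    · simpa only [literal, if_neg hk] using .not (.basic (hθ k))
  · simp only [Formula.realize_iSup, Formula.realize_iInf, hliteral]
    constructor
    · rintro ⟨⟨p, w, hw, hwp⟩, hvp⟩
      exact (hP v w fun k => (hvp k).trans (hwp k).symm).2 hw
    · exact fun hv => ⟨⟨fun k => (θ k).Realize v, v, hv, fun _ => Iff.rfl⟩, fun _ => Iff.rfl⟩

end BooleanCombinations

section QuantifierElimination

variable {L : FirstOrder.Language.{u, v}} {M : Type*} [L.Structure M]

/-- The tuples `f` and `g` satisfy the same equalities and the same atomic formulas built from the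
relation symbols in `I`. -/
structure AgreeOn {β : Type*} (I : Set (Σ k, L.Relations k)) (f g : β → M) : Prop where
  eq_iff (b c : β) : f b = f c ↔ g b = g c
  relMap_iff {k : ℕ} (R : L.Relations k) (hR : ⟨k, R⟩ ∈ I) (e : Fin k → β) :
    RelMap R (f ∘ e) ↔ RelMap R (g ∘ e)

namespace AgreeOn

variable {β γ : Type*} {I J : Set (Σ k, L.Relations k)} {f g : β → M}

theorem symm (h : AgreeOn I f g) : AgreeOn I g f :=
  ⟨fun b c => (h.eq_iff b c).symm, fun R hR e => (h.relMap_iff R hR e).symm⟩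

theorem mono (h : AgreeOn J f g) (hIJ : I ⊆ J) : AgreeOn I f g :=
  ⟨h.eq_iff, fun R hR => h.relMap_iff R (hIJ hR)⟩

theorem comp (h : AgreeOn I f g) (e : γ → β) : AgreeOn I (f ∘ e) (g ∘ e) :=
  ⟨fun _ _ => h.eq_iff _ _, fun R hR e' => h.relMap_iff R hR (e ∘ e')⟩

theorem option_elim'_apply (h : AgreeOn I f g) (b : β) :
    AgreeOn I (Option.elim' (f b) f) (Option.elim' (g b) g) := by
  have helim (u : β → M) : Option.elim' (u b) u = u ∘ fun o => o.getD b := by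
    ext (_ | c) <;> rfl
  simpa only [helim] using h.comp _

theorem sumElim_snoc {α : Type*} {n : ℕ} {v w : α → M} {x z : Fin n → M} {a b : M}
    (h : AgreeOn I (Option.elim' a (Sum.elim v x)) (Option.elim' b (Sum.elim w z))) :
    AgreeOn I (Sum.elim v (Fin.snoc x a : Fin (n + 1) → M))
      (Sum.elim w (Fin.snoc z b : Fin (n + 1) → M)) := by
  let e : α ⊕ Fin (n + 1) → Option (α ⊕ Fin n) :=
    Sum.elim (some ∘ Sum.inl) (Fin.snoc (some ∘ Sum.inr) none)
  have he (u : α → M) (y : Fin n → M) (c : M) :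
      Sum.elim u (Fin.snoc y c : Fin (n + 1) → M) = Option.elim' c (Sum.elim u y) ∘ e := by
    ext (i | i)
    · rfl
    · cases i using Fin.lastCases <;> simp [e]
  simpa only [he] using h.comp e

end AgreeOn

variable (L M) in
/-- The back-and-forth property, stated for the finite sublanguages of `L`: agreement of two finite
tuples survives adjoining a new entry to one of them, for a suitable new entry of the other. -/
def HasExtensionProperty : Prop :=
  ∀ ⦃β : Type⦄ [Finite β] ⦃I : Set (Σ k, L.Relations k)⦄, I.Finite → ∀ ⦃f g : β → M⦄,
    AgreeOn I f g → ∀ a, ∃ b, AgreeOn I (Option.elim' a f) (Option.elim' b g)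

variable [L.IsRelational]

theorem exists_eq_var_of_isRelational {α : Type*} (t : L.Term α) : ∃ a, t = Term.var a := by
  cases t with
  | var a => exact ⟨a, rfl⟩
  | func f _ => exact isEmptyElim f

namespace HasExtensionProperty

variable {α : Type} (hM : HasExtensionProperty L M)
include hM

theorem exists_finite_boundedFormula_realize_iff [Finite α] {n : ℕ} (φ : L.BoundedFormula α n) :
    ∃ I : Set (Σ k, L.Relations k), I.Finite ∧ ∀ (v w : α → M) (x z : Fin n → M),
      AgreeOn I (Sum.elim v x) (Sum.elim w z) → (φ.Realize v x ↔ φ.Realize w z) := by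
  induction φ with
  | falsum => exact ⟨∅, Set.finite_empty, fun _ _ _ _ _ => Iff.rfl⟩
  | equal t₁ t₂ =>
    obtain ⟨a, rfl⟩ := exists_eq_var_of_isRelational t₁
    obtain ⟨b, rfl⟩ := exists_eq_var_of_isRelational t₂
    exact ⟨∅, Set.finite_empty, fun v w x z h => h.eq_iff a b⟩
  | rel R ts =>
    choose e he using fun i => exists_eq_var_of_isRelational (ts i)
    obtain rfl : ts = fun i => Term.var (e i) := funext he
    exact ⟨{⟨_, R⟩}, Set.finite_singleton _, fun v w x z h => h.relMap_iff R rfl e⟩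
  | imp φ ψ ihφ ihψ =>
    obtain ⟨I, hI, hφ⟩ := ihφ
    obtain ⟨J, hJ, hψ⟩ := ihψ
    refine ⟨I ∪ J, hI.union hJ, fun v w x z h => ?_⟩
    rw [BoundedFormula.realize_imp, BoundedFormula.realize_imp,
      hφ v w x z (h.mono Set.subset_union_left), hψ v w x z (h.mono Set.subset_union_right)]
  | all φ ih =>
    obtain ⟨I, hI, hφ⟩ := ih
    have transfer {v w : α → M} {x z} (h : AgreeOn I (Sum.elim v x) (Sum.elim w z))
        (hw : φ.all.Realize w z) : φ.all.Realize v x := fun a => by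
      obtain ⟨b, hab⟩ := hM hI h a
      exact (hφ v w _ _ hab.sumElim_snoc).2 (hw b)
    exact ⟨I, hI, fun v w x z h => ⟨transfer h.symm, transfer h⟩⟩

theorem exists_finite_realize_iff [Finite α] (φ : L.Formula α) :
    ∃ I : Set (Σ k, L.Relations k), I.Finite ∧ ∀ v w : α → M,
      AgreeOn I v w → (φ.Realize v ↔ φ.Realize w) := by
  obtain ⟨I, hI, hφ⟩ := hM.exists_finite_boundedFormula_realize_iff φ
  refine ⟨I, hI, fun v w h => hφ v w _ _ ?_⟩
  have helim (u : α → M) : Sum.elim u (default : Fin 0 → M) = u ∘ Sum.elim id Fin.elim0 := by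
    ext (_ | i)
    · rfl
    · exact i.elim0
  simpa only [helim] using h.comp _

theorem exists_isBoolComb_iff_of_atomic_mem [Nonempty M] {S : Set (L.Formula α)}
    (hequal : ∀ a b : α, Term.equal (Term.var a) (Term.var b) ∈ S)
    (hrel : ∀ ⦃k⦄ (R : L.Relations k) (e : Fin k → α), (R.formula Term.var).relabel e ∈ S)
    (φ : L.Formula α) :
    ∃ ψ, IsBoolComb S ψ ∧ (L.completeTheory M).Iff φ ψ := by
  classical
  let V : Finset α := φ.freeVarFinset
  let φV : L.Formula V := φ.restrictFreeVar id
  have hφV (v : α → M) : φV.Realize (fun a => v a) ↔ φ.Realize v :=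
    BoundedFormula.realize_restrictFreeVar v fun _ => rfl
  obtain ⟨I, hI, hIφ⟩ := hM.exists_finite_realize_iff φV
  have := hI.to_subtype
  let atom : (V × V) ⊕ (Σ R : I, Fin R.1.1 → V) → L.Formula α :=
    Sum.elim (fun p => Term.equal (Term.var (p.1 : α)) (Term.var (p.2 : α)))
      fun p => (p.1.1.2.formula Term.var).relabel fun j => (p.2 j : α)
  have hatom : ∀ p, atom p ∈ S := by
    rintro (p | p)
    exacts [hequal _ _, hrel _ _]
  obtain ⟨ψ, hψ, hψφ⟩ := exists_isBoolComb_realize_iff (M := M) (P := φ.Realize) hatom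
    fun v w h => by
      rw [← hφV, ← hφV]
      refine hIφ _ _ ⟨fun a b => ?_, fun R hR e => ?_⟩
      · simpa only [atom, Sum.elim_inl, Formula.realize_equal, Term.realize_var] using
          h (.inl (a, b))
      · simpa only [atom, Sum.elim_inr, Formula.realize_relabel, Formula.realize_rel,
          Term.realize_var, Function.comp_def] using h (.inr ⟨⟨⟨_, R⟩, hR⟩, e⟩)
  exact ⟨ψ, hψ, (completeTheory_iff_iff _ _).2 fun v => (hψφ v).symm⟩

end HasExtensionProperty

end QuantifierElimination

section AlmostAry

variable {L : FirstOrder.Language.{u, v}} {T : L.Theory} {n l : ℕ}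

theorem isNFormula_relabel {k : ℕ} (hk : k ≤ n) (φ : L.Formula (Fin k)) (g : Fin k → ℕ) :
    IsNFormula T n (φ.relabel g) := by
  let g' : Fin n → ℕ := fun j => if hj : j.1 < k then g ⟨j, hj⟩ else 0
  have hg' : g' ∘ Fin.castLE hk = g := by
    ext j
    simp [g']
  refine ⟨(φ.relabel (Fin.castLE hk)).relabel g', .basic ⟨_, Set.mem_univ _, g', rfl⟩, ?_⟩
  refine Theory.models_formula_iff.2 fun N v => Formula.realize_iff.2 ?_
  simp only [Formula.realize_relabel, Function.comp_assoc, hg']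

theorem aar_eq (hn : 1 ≤ n) (h : AlmostAry T n) (hlt : ∀ k < n, ¬ AlmostAry T k) : aar T = n := by
  refine le_antisymm (sInf_le ⟨n, rfl, hn, h⟩) (le_sInf ?_)
  rintro _ ⟨k, rfl, -, hk⟩
  exact Nat.cast_le.2 (not_lt.1 fun hkn => hlt k hkn hk)

theorem hasAarDegree_of_witnessesAlmostAry {m r : ℕ} {Φ : Finset (L.Formula (Fin r))}
    (hT : aar T = n) (hΦ : WitnessesAlmostAry T n Φ) (hΦm : Φ.card ≤ m)
    (length_le : ∀ {l} {Ψ : Finset (L.Formula (Fin l))}, WitnessesAlmostAry T n Ψ → r ≤ l)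
    (card_le : ∀ {Ψ : Finset (L.Formula (Fin r))}, WitnessesAlmostAry T n Ψ → m ≤ Ψ.card) :
    HasAarDegree T m r :=
  ⟨n, hT, ⟨⟨Φ, hΦ⟩, fun _ ⟨_, hΨ⟩ => length_le hΨ⟩,
    ⟨⟨Φ, hΦm.antisymm (card_le hΦ), hΦ⟩, fun _ ⟨_, hk, hΨ⟩ => hk ▸ card_le hΨ⟩⟩

variable {M : Type*} [L.Structure M] [Nonempty M]

theorem HasExtensionProperty.witnessesAlmostAry [L.IsRelational] (hM : HasExtensionProperty L M)
    (hn : 2 ≤ n) {Φ : Finset (L.Formula (Fin l))}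
    (hΦ : ∀ ⦃k⦄ (R : L.Relations k), n < k → ∀ e : Fin k → ℕ,
      (R.formula Term.var).relabel e ∈ substInstances (Φ : Set (L.Formula (Fin l)))) :
    WitnessesAlmostAry (L.completeTheory M) n Φ := by
  refine hM.exists_isBoolComb_iff_of_atomic_mem (fun a b => .inl ?_) fun k R e => ?_
  · exact isNFormula_relabel hn (Term.equal (Term.var 0) (Term.var 1)) ![a, b]
  · rcases le_or_gt k n with hk | hk
    exacts [.inl (isNFormula_relabel hk _ e), .inr (hΦ R hk e)]

variable [M ⊨ T] {v w : ℕ → M}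
  (hvw : ∀ (φ : L.Formula (Fin n)) (g : Fin n → ℕ), φ.Realize (v ∘ g) ↔ φ.Realize (w ∘ g))
include hvw

theorem IsNFormula.realize_iff {χ : L.Formula ℕ} (hχ : IsNFormula T n χ) :
    χ.Realize v ↔ χ.Realize w := by
  obtain ⟨ψ, hψ, hχψ⟩ := hχ
  rw [hχψ.realize_iff, hχψ.realize_iff]
  refine hψ.realize_iff ?_
  rintro _ ⟨φ, -, g, rfl⟩
  simpa only [Formula.realize_relabel] using hvw φ g

theorem WitnessesAlmostAry.realize_iff {Φ : Finset (L.Formula (Fin l))}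
    (hΦ : WitnessesAlmostAry T n Φ)
    (hvwΦ : ∀ φ ∈ Φ, ∀ g : Fin l → ℕ, φ.Realize (v ∘ g) ↔ φ.Realize (w ∘ g))
    (φ : L.Formula ℕ) : φ.Realize v ↔ φ.Realize w := by
  obtain ⟨ψ, hψ, hφψ⟩ := hΦ φ
  rw [hφψ.realize_iff, hφψ.realize_iff]
  refine hψ.realize_iff ?_
  rintro χ (hχ | ⟨χ, hχ, g, rfl⟩)
  · exact IsNFormula.realize_iff hvw hχ
  · simpa only [Formula.realize_relabel] using hvwΦ χ hχ g

end AlmostAry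

section FinsetImages

variable {β γ : Type*}

theorem exists_injective_image_univ_eq [DecidableEq β] {k : ℕ} {s : Finset β} (hs : s.card = k) :
    ∃ e : Fin k → β, Function.Injective e ∧ Finset.univ.image e = s := by
  let e := (s.equivFinOfCardEq hs).symm
  refine ⟨fun j => e j, Subtype.val_injective.comp e.injective, ?_⟩
  ext x
  simpa using ⟨fun ⟨j, hj⟩ => hj ▸ (e j).2, fun hx => ⟨e.symm ⟨x, hx⟩, by simp⟩⟩

variable [DecidableEq γ]

theorem exists_injOn_image_eq_image (f : β → γ) (s : Finset β) :
    ∃ t : Finset β, Set.InjOn f t ∧ t.image f = s.image f := by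
  have hf : Set.SurjOn f s (s.image f) := by
    rw [Finset.coe_image]
    exact Set.surjOn_image f s
  obtain ⟨t, -, ht⟩ := Finset.exists_subset_injOn_image_eq_of_surjOn _ _ hf
  exact ⟨t, ht⟩

theorem image_subset_image_of_factorsThrough {f g : β → γ} (h : g.FactorsThrough f)
    {s t : Finset β} (hst : s.image f ⊆ t.image f) : s.image g ⊆ t.image g := by
  intro y hy
  obtain ⟨b, hb, rfl⟩ := Finset.mem_image.1 hy
  obtain ⟨c, hc, hcb⟩ := Finset.mem_image.1 (hst (Finset.mem_image_of_mem f hb))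
  exact Finset.mem_image.2 ⟨c, hc, h hcb⟩

theorem image_eq_image_of_factorsThrough {f g : β → γ} (h : g.FactorsThrough f)
    {s t : Finset β} (hst : s.image f = t.image f) : s.image g = t.image g :=
  (image_subset_image_of_factorsThrough h hst.subset).antisymm
    (image_subset_image_of_factorsThrough h hst.superset)

theorem card_image_le_of_factorsThrough {f g : β → γ} (h : g.FactorsThrough f) (s : Finset β) :
    (s.image g).card ≤ (s.image f).card := by
  obtain ⟨t, ht, hts⟩ := exists_injOn_image_eq_image f s
  rw [← hts, Finset.card_image_of_injOn ht, image_eq_image_of_factorsThrough h hts.symm]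
  exact Finset.card_image_le

theorem image_option_elim' [DecidableEq β] (f : β → γ) (c : γ) (s : Finset (Option β)) :
    s.image (Option.elim' c f) =
      if none ∈ s then insert c (s.eraseNone.image f) else s.eraseNone.image f := by
  ext z
  split_ifs with hs <;>
    simp only [Finset.mem_image, Finset.mem_insert, Finset.mem_eraseNone, Option.exists,
      Option.elim', hs, true_and, false_and, false_or, eq_comm]

end FinsetImages

section Hypergraphs

variable {ι : Type*}

/-- The relational language with one relation symbol, of arity `ar i`, for each `i`. -/
def hypergraphLanguage (ar : ι → ℕ) : FirstOrder.Language.{0, _} :=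
  ⟨fun _ => Empty, fun k => {i // ar i = k}⟩

instance (ar : ι → ℕ) : (hypergraphLanguage ar).IsRelational :=
  fun _ => inferInstanceAs (IsEmpty Empty)

/-- The relation symbol of `hypergraphLanguage ar` indexed by `i`. -/
def edgeSymbol (ar : ι → ℕ) (i : ι) : (hypergraphLanguage ar).Relations (ar i) :=
  ⟨i, rfl⟩

/-- A family of uniform hypergraphs on a common vertex set `M`: the edges of the hypergraph indexed
by `i` are nonempty sets of `ar i` vertices. -/
class HypergraphFamily (ar : ι → ℕ) (M : Type*) where
  Edge : ι → Finset M → Prop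
  card_eq {i : ι} {s : Finset M} : Edge i s → s.card = ar i
  nonempty {i : ι} {s : Finset M} : Edge i s → s.Nonempty

variable {ar : ι → ℕ} {M : Type*} [DecidableEq M] [HypergraphFamily ar M]

open HypergraphFamily

instance : (hypergraphLanguage ar).Structure M where
  funMap f := Empty.elim f
  RelMap R x := Edge ar R.1 (Finset.univ.image x)

theorem relMap_edgeSymbol_iff {i : ι} {x : Fin (ar i) → M} :
    RelMap (edgeSymbol ar i) x ↔ Edge ar i (Finset.univ.image x) :=
  Iff.rfl

theorem AgreeOn.edge_image {β : Type*}
    {I : Set (Σ k, (hypergraphLanguage ar).Relations k)} {f g : β → M} (h : AgreeOn I f g) {i : ι}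
    (hi : ⟨ar i, edgeSymbol ar i⟩ ∈ I) {s : Finset β} (hs : Edge ar i (s.image f)) :
    Edge ar i (s.image g) := by
  classical
  obtain ⟨t, ht, hts⟩ := exists_injOn_image_eq_image f s
  have htcard : t.card = ar i := by rw [← card_eq hs, ← hts, Finset.card_image_of_injOn ht]
  obtain ⟨e, -, rfl⟩ := exists_injective_image_univ_eq htcard
  have hgs : Finset.univ.image (g ∘ e) = s.image g := by
    rw [← Finset.image_image]
    exact image_eq_image_of_factorsThrough (fun b c => (h.eq_iff b c).1) hts
  rw [← hts, Finset.image_image, ← relMap_edgeSymbol_iff] at hs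
  rw [← hgs, ← relMap_edgeSymbol_iff]
  exact (h.relMap_iff _ hi e).1 hs

theorem agreeOn_iff_edge_image_iff {β : Type*}
    {I : Set (Σ k, (hypergraphLanguage ar).Relations k)} {f g : β → M} :
    AgreeOn I f g ↔ (∀ b c, f b = f c ↔ g b = g c) ∧ ∀ i, ⟨ar i, edgeSymbol ar i⟩ ∈ I →
      ∀ s : Finset β, Edge ar i (s.image f) ↔ Edge ar i (s.image g) := by
  classical
  refine ⟨fun h => ⟨h.eq_iff, fun i hi s => ⟨h.edge_image hi, h.symm.edge_image hi⟩⟩,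
    fun h => ⟨h.1, ?_⟩⟩
  rintro _ ⟨i, rfl⟩ hi e
  have hedge := h.2 i hi (Finset.univ.image e)
  rwa [Finset.image_image, Finset.image_image] at hedge

variable (ar M) in
/-- Every finitely supported system of links over a finite set `A` of vertices is realized by a
vertex outside `A`: the sets `s ⊆ A` that this vertex completes to an edge of the hypergraph `i` are
those of the right size with `(i, s) ∈ F`. -/
def HypergraphFamily.IsGeneric : Prop :=
  ∀ (A : Finset M) (F : Finset (ι × Finset M)), ∃ y ∉ A, ∀ i, ∀ s ⊆ A,
    Edge ar i (insert y s) ↔ (i, s) ∈ F ∧ s.card + 1 = ar i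

namespace HypergraphFamily.IsGeneric

variable (hM : IsGeneric ar M)
include hM

theorem exists_edge_insert_iff {β : Type*} [Finite β] {f g : β → M}
    (hfg : ∀ b c, f b = f c ↔ g b = g c) {a : M} (ha : a ∉ Set.range f) (J : Finset ι) :
    ∃ b ∉ Set.range g, ∀ i ∈ J, ∀ s : Finset β,
      Edge ar i (insert a (s.image f)) ↔ Edge ar i (insert b (s.image g)) := by
  classical
  cases nonempty_fintype β
  let F : Finset (ι × Finset M) :=
    {p ∈ J ×ˢ (Finset.univ.image g).powerset |
      ∃ s : Finset β, s.image g = p.2 ∧ Edge ar p.1 (insert a (s.image f))}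
  obtain ⟨b, hb, hbF⟩ := hM (Finset.univ.image g) F
  refine ⟨b, by simpa using hb, fun i hi s => ?_⟩
  have hsg : s.image g ⊆ Finset.univ.image g := Finset.image_subset_image s.subset_univ
  have hcard : (s.image g).card = (s.image f).card :=
    (card_image_le_of_factorsThrough (fun b c => (hfg b c).1) s).antisymm
      (card_image_le_of_factorsThrough (fun b c => (hfg b c).2) s)
  have hacard : (insert a (s.image f)).card = (s.image f).card + 1 :=
    Finset.card_insert_of_notMem fun h =>
      ha ((Finset.mem_image.1 h).imp fun _ => And.right)
  have hmem : (i, s.image g) ∈ F ↔ Edge ar i (insert a (s.image f)) := by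
    simp only [F, Finset.mem_filter, Finset.mem_product, Finset.mem_powerset, hi, hsg, true_and]
    refine ⟨?_, fun h => ⟨s, rfl, h⟩⟩
    rintro ⟨t, hts, ht⟩
    rwa [image_eq_image_of_factorsThrough (fun b c => (hfg b c).2) hts] at ht
  rw [hbF i _ hsg, hmem, hcard, ← hacard, iff_self_and]
  exact card_eq

theorem hasExtensionProperty : HasExtensionProperty (hypergraphLanguage ar) M := by
  classical
  intro β _ I hI f g h a
  cases nonempty_fintype β
  by_cases ha : a ∈ Set.range f
  · obtain ⟨b, rfl⟩ := ha
    exact ⟨g b, h.option_elim'_apply b⟩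
  obtain ⟨b, hb, hab⟩ :=
    hM.exists_edge_insert_iff h.eq_iff ha (hI.toFinset.image fun R => R.2.1)
  have hedge := (agreeOn_iff_edge_image_iff.1 h).2
  refine ⟨b, agreeOn_iff_edge_image_iff.2 ⟨?_, fun i hi s => ?_⟩⟩
  · have ha' (c : β) : f c ≠ a := fun hc => ha ⟨c, hc⟩
    have hb' (c : β) : g c ≠ b := fun hc => hb ⟨c, hc⟩
    rintro (_ | c) (_ | d)
    exacts [by simp, by simp [(ha' d).symm, (hb' d).symm], by simp [ha' c, hb' c], h.eq_iff c d]
  · have hiJ : i ∈ hI.toFinset.image fun R => R.2.1 :=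
      Finset.mem_image_of_mem (fun R => R.2.1) (hI.mem_toFinset.2 hi)
    rw [image_option_elim', image_option_elim']
    split_ifs
    exacts [hab i hiJ _, hedge i hi _]

theorem exists_edge_iff_eq_insert {B : Finset M} (hB : ∀ i, ∀ t ⊆ B, ¬ Edge ar i t)
    (F : Finset ι) : ∃ y ∉ B, ∀ i, ∀ t ⊆ insert y B,
      Edge ar i t ↔ t = insert y B ∧ i ∈ F ∧ ar i = B.card + 1 := by
  obtain ⟨y, hy, hyB⟩ := hM B (F ×ˢ {B})
  refine ⟨y, hy, fun i t ht => ?_⟩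
  by_cases hyt : y ∈ t
  · have hins : t = insert y B ↔ t.erase y = B :=
      ⟨fun h => h ▸ Finset.erase_insert hy, fun h => h ▸ (Finset.insert_erase hyt).symm⟩
    have hedge := hyB i (t.erase y) (Finset.subset_insert_iff.1 ht)
    rw [Finset.insert_erase hyt] at hedge
    rw [hedge, hins, Finset.mem_product, Finset.mem_singleton]
    grind
  · exact iff_of_false (hB i t ((Finset.subset_insert_iff_of_notMem hyt).1 ht))
      fun h => hyt (h.1 ▸ Finset.mem_insert_self y B)

theorem exists_card_eq_forall_not_edge (k : ℕ) :
    ∃ B : Finset M, B.card = k ∧ ∀ i, ∀ t ⊆ B, ¬ Edge ar i t := by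
  induction k with
  | zero => exact ⟨∅, rfl, fun i t ht h => (nonempty h).ne_empty (Finset.subset_empty.1 ht)⟩
  | succ k ih =>
    obtain ⟨B, rfl, hB⟩ := ih
    obtain ⟨y, hy, hyB⟩ := hM.exists_edge_iff_eq_insert hB ∅
    refine ⟨insert y B, Finset.card_insert_of_notMem hy, fun i t ht h => ?_⟩
    exact Finset.notMem_empty i ((hyB i t ht).1 h).2.1

end HypergraphFamily.IsGeneric

section Simplices

variable {k l : ℕ} {F G : Finset ι}

variable (ar) in
/-- The vertices `a 0, …, a (k - 1)` are distinct, no proper subset of them is an edge, and together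
they form an edge of precisely those `k`-uniform hypergraphs whose index lies in `F`. -/
structure IsSimplex (F : Finset ι) (a : Fin k → M) : Prop where
  injective : Function.Injective a
  edge_image_iff (i : ι) (s : Finset (Fin k)) :
    Edge ar i (s.image a) ↔ s = Finset.univ ∧ i ∈ F ∧ ar i = k

theorem HypergraphFamily.IsGeneric.exists_isSimplex (hM : IsGeneric ar M) (k : ℕ) [NeZero k]
    (F : Finset ι) : ∃ a : Fin k → M, IsSimplex ar F a := by
  obtain ⟨j, rfl⟩ := Nat.exists_eq_succ_of_ne_zero (NeZero.ne k)
  obtain ⟨B, rfl, hB⟩ := hM.exists_card_eq_forall_not_edge j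
  obtain ⟨y, hy, hyB⟩ := hM.exists_edge_iff_eq_insert hB F
  obtain ⟨a, ha, haB⟩ := exists_injective_image_univ_eq (Finset.card_insert_of_notMem hy)
  rw [← haB] at hyB
  refine ⟨a, ha, fun i s => (hyB i _ (Finset.image_subset_image s.subset_univ)).trans ?_⟩
  rw [(Finset.image_injective ha).eq_iff]

namespace IsSimplex

variable {a b : Fin k → M}

theorem relMap_comp_iff (ha : IsSimplex ar F a) (R : (hypergraphLanguage ar).Relations l)
    (e : Fin l → Fin k) :
    RelMap R (a ∘ e) ↔ Function.Surjective e ∧ R.1 ∈ F ∧ ar R.1 = k := by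
  change Edge ar R.1 (Finset.univ.image (a ∘ e)) ↔ _
  rw [← Finset.image_image, ha.edge_image_iff, ← Finset.coe_inj, Finset.coe_image,
    Finset.coe_univ, Set.image_univ, Finset.coe_univ, Set.range_eq_univ]

theorem agreeOn_comp (ha : IsSimplex ar F a) (hb : IsSimplex ar G b) {β : Type*} {g : β → Fin k}
    {I : Set (Σ k, (hypergraphLanguage ar).Relations k)}
    (hI : ∀ R ∈ I, Function.Surjective g → (R.2.1 ∈ F ↔ R.2.1 ∈ G)) :
    AgreeOn I (a ∘ g) (b ∘ g) := by
  refine ⟨fun x y => ha.injective.eq_iff.trans hb.injective.eq_iff.symm, fun R hR e => ?_⟩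
  rw [Function.comp_assoc, Function.comp_assoc, ha.relMap_comp_iff, hb.relMap_comp_iff]
  exact and_congr_right fun he => and_congr_left' (hI _ hR he.of_comp)

theorem agreeOn_comp_self (ha : IsSimplex ar F a) {g : Fin k → Fin k} (hg : Function.Bijective g)
    (I : Set (Σ k, (hypergraphLanguage ar).Relations k)) : AgreeOn I (a ∘ g) a := by
  refine ⟨fun x y => ha.injective.eq_iff.trans (hg.1.eq_iff.trans ha.injective.eq_iff.symm),
    fun R _ e => ?_⟩
  rw [Function.comp_assoc, ha.relMap_comp_iff, ha.relMap_comp_iff,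
    Function.Surjective.of_comp_iff' hg]

theorem realize_comp_iff_of_not_surjective (ha : IsSimplex ar F a) (hb : IsSimplex ar G b)
    (hM : HasExtensionProperty (hypergraphLanguage ar) M) {g : Fin l → Fin k}
    (hg : ¬ Function.Surjective g) (φ : (hypergraphLanguage ar).Formula (Fin l)) :
    φ.Realize (a ∘ g) ↔ φ.Realize (b ∘ g) := by
  obtain ⟨I, -, hI⟩ := hM.exists_finite_realize_iff φ
  exact hI _ _ (ha.agreeOn_comp hb fun _ _ h => absurd h hg)

theorem realize_comp_iff_of_bijective (ha : IsSimplex ar F a)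
    (hM : HasExtensionProperty (hypergraphLanguage ar) M) {g : Fin k → Fin k}
    (hg : Function.Bijective g) (φ : (hypergraphLanguage ar).Formula (Fin k)) :
    φ.Realize (a ∘ g) ↔ φ.Realize a := by
  obtain ⟨I, -, hI⟩ := hM.exists_finite_realize_iff φ
  exact hI _ _ (ha.agreeOn_comp_self hg I)

end IsSimplex

end Simplices

theorem not_surjective_of_lt {k l : ℕ} (h : l < k) (g : Fin l → Fin k) :
    ¬ Function.Surjective g :=
  mt (Fintype.card_le_of_surjective g) (by simpa using h)

section LowerBounds

variable {n l : ℕ} {T : (hypergraphLanguage ar).Theory} [Nonempty M] [M ⊨ T]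

theorem IsSimplex.mem_iff_of_witnessesAlmostAry {i : ι} {F G : Finset ι} {a b : Fin (ar i) → M}
    (ha : IsSimplex ar F a) (hb : IsSimplex ar G b)
    (hM : HasExtensionProperty (hypergraphLanguage ar) M) (hn : n < ar i)
    {Φ : Finset ((hypergraphLanguage ar).Formula (Fin l))} (hΦ : WitnessesAlmostAry T n Φ)
    (hab : ∀ φ ∈ Φ, ∀ g : Fin l → Fin (ar i), φ.Realize (a ∘ g) ↔ φ.Realize (b ∘ g)) :
    i ∈ F ↔ i ∈ G := by
  have : NeZero (ar i) := ⟨hn.ne_bot⟩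
  let φ := ((edgeSymbol ar i).formula Term.var).relabel Fin.val
  have hφ {H : Finset ι} {c : Fin (ar i) → M} (hc : IsSimplex ar H c) :
      φ.Realize (c ∘ Fin.ofNat (ar i)) ↔ i ∈ H := by
    have hval : Fin.ofNat (ar i) ∘ Fin.val = id := funext Fin.ofNat_val_eq_self
    rw [Formula.realize_relabel, Formula.realize_rel, Function.comp_assoc, hval]
    refine (hc.relMap_comp_iff (edgeSymbol ar i) id).trans ?_
    simp [Function.surjective_id, edgeSymbol]
  rw [← hφ ha, ← hφ hb]
  refine hΦ.realize_iff (fun χ g => ?_) (fun χ hχ g => hab χ hχ (Fin.ofNat (ar i) ∘ g)) φ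
  exact ha.realize_comp_iff_of_not_surjective hb hM (not_surjective_of_lt hn _) χ

namespace HypergraphFamily.IsGeneric

variable (hM : IsGeneric ar M)
include hM

theorem not_almostAry {k : ℕ} (har : {i | ar i = n}.Infinite) (hk : k < n) :
    ¬ AlmostAry T k := by
  classical
  rintro ⟨l, Φ, hΦ⟩
  have hext := hM.hasExtensionProperty
  choose I hIfin hI using fun φ : (hypergraphLanguage ar).Formula (Fin l) =>
    hext.exists_finite_realize_iff φ
  have hIΦ : (⋃ φ ∈ Φ, (fun R => R.2.1) '' I φ : Set ι).Finite :=
    Φ.finite_toSet.biUnion fun φ _ => (hIfin φ).image _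
  obtain ⟨i, rfl, hi⟩ := har.exists_notMem_finite hIΦ
  have : NeZero (ar i) := ⟨hk.ne_bot⟩
  obtain ⟨a, ha⟩ := hM.exists_isSimplex (ar i) {i}
  obtain ⟨b, hb⟩ := hM.exists_isSimplex (ar i) ∅
  have hmem := ha.mem_iff_of_witnessesAlmostAry hb hext hk hΦ fun φ hφ g =>
    hI φ _ _ <| ha.agreeOn_comp hb fun R hR _ => by
      have hRi : R.2.1 ≠ i := fun h => hi (Set.mem_biUnion hφ ⟨R, hR, h⟩)
      simpa using hRi
  simp at hmem

theorem arity_le_of_witnessesAlmostAry {i : ι} (hn : n < ar i)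
    {Φ : Finset ((hypergraphLanguage ar).Formula (Fin l))} (hΦ : WitnessesAlmostAry T n Φ) :
    ar i ≤ l := by
  by_contra! hl
  have : NeZero (ar i) := ⟨hn.ne_bot⟩
  obtain ⟨a, ha⟩ := hM.exists_isSimplex (ar i) {i}
  obtain ⟨b, hb⟩ := hM.exists_isSimplex (ar i) ∅
  have hext := hM.hasExtensionProperty
  have hmem := ha.mem_iff_of_witnessesAlmostAry hb hext hn hΦ fun φ _ _ =>
    ha.realize_comp_iff_of_not_surjective hb hext (not_surjective_of_lt hl _) φ
  simp at hmem

theorem card_le_card_of_witnessesAlmostAry {I : Finset ι} {r : ℕ} (hI : ∀ i ∈ I, ar i = r)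
    (hn : n < r) {Φ : Finset ((hypergraphLanguage ar).Formula (Fin r))}
    (hΦ : WitnessesAlmostAry T n Φ) : I.card ≤ Φ.card := by
  classical
  have : NeZero r := ⟨hn.ne_bot⟩
  have hext := hM.hasExtensionProperty
  choose a ha using hM.exists_isSimplex r
  -- `Φ` tells apart the `2 ^ #I` simplices `a F` with `F ⊆ I`, by the formulas true in `a F`.
  let trueIn (F : Finset ι) : Finset ((hypergraphLanguage ar).Formula (Fin r)) :=
    {φ ∈ Φ | φ.Realize (a F)}
  have realize_iff {F G : Finset ι} (hFG : trueIn F = trueIn G) :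
      ∀ φ ∈ Φ, ∀ g : Fin r → Fin r, φ.Realize (a F ∘ g) ↔ φ.Realize (a G ∘ g) := by
    intro φ hφ g
    by_cases hg : Function.Surjective g
    · have hg' := Finite.surjective_iff_bijective.1 hg
      rw [(ha F).realize_comp_iff_of_bijective hext hg',
        (ha G).realize_comp_iff_of_bijective hext hg']
      simpa [trueIn, hφ] using Finset.ext_iff.1 hFG φ
    · exact (ha F).realize_comp_iff_of_not_surjective (ha G) hext hg φ
  have hinj : Set.InjOn trueIn I.powerset := by
    intro F hF G hG hFG
    have mem_iff (i : ι) (hi : i ∈ I) : i ∈ F ↔ i ∈ G := by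
      obtain rfl := hI i hi
      exact (ha F).mem_iff_of_witnessesAlmostAry (ha G) hext hn hΦ (realize_iff hFG)
    ext i
    exact ⟨fun h => (mem_iff i (Finset.mem_powerset.1 hF h)).1 h,
      fun h => (mem_iff i (Finset.mem_powerset.1 hG h)).2 h⟩
  have hcard : I.powerset.card ≤ Φ.powerset.card :=
    Finset.card_le_card_of_injOn trueIn
      (fun F _ => Finset.mem_powerset.2 (Finset.filter_subset _ _)) hinj
  rwa [Finset.card_powerset, Finset.card_powerset, Nat.pow_le_pow_iff_right one_lt_two] at hcard

end HypergraphFamily.IsGeneric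

end LowerBounds

end Hypergraphs

section Existence

theorem exists_nat_map_infinite_fibers (α : Type*) [Countable α] [Nonempty α] :
    ∃ c : ℕ → α, ∀ a, {y | c y = a}.Infinite := by
  obtain ⟨f, hf⟩ := exists_surjective_nat α
  refine ⟨fun y => f y.unpair.1, fun a => ?_⟩
  obtain ⟨x, rfl⟩ := hf a
  refine Set.infinite_of_injective_forall_mem (f := Nat.pair x) ?_ fun z => by simp
  exact fun y z h => (Nat.pair_eq_pair.1 h).2

variable {ι : Type*}

/-- The family of hypergraphs on a linear order in which `s` with greatest element `y` is an edge of
the hypergraph `i` when it has the right size and `(i, s \ {y})` is listed in `code y`. -/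
abbrev HypergraphFamily.ofCode {M : Type*} [LinearOrder M] (ar : ι → ℕ)
    (code : M → Finset (ι × Finset M)) : HypergraphFamily ar M where
  Edge i s := s.card = ar i ∧ ∃ y, IsGreatest (s : Set M) y ∧ (i, s.erase y) ∈ code y
  card_eq h := h.1
  nonempty := fun ⟨_, y, hy, _⟩ => ⟨y, hy.1⟩

theorem HypergraphFamily.exists_isGeneric [Countable ι] (ar : ι → ℕ) :
    ∃ _ : HypergraphFamily ar ℕ, IsGeneric ar ℕ := by
  obtain ⟨code, hcode⟩ := exists_nat_map_infinite_fibers (Finset (ι × Finset ℕ))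
  refine ⟨.ofCode ar code, fun A F => ?_⟩
  obtain ⟨y, rfl, hy⟩ := (hcode F).exists_gt (A.sup id)
  have hlt (z : ℕ) (hz : z ∈ A) : z < y := (Finset.le_sup (f := id) hz).trans_lt hy
  refine ⟨y, fun hyA => (hlt y hyA).false, fun i s hs => ?_⟩
  have hys : y ∉ s := fun h => (hlt y (hs h)).false
  have hgreatest : IsGreatest (↑(insert y s) : Set ℕ) y :=
    ⟨by simp, by simpa [upperBounds] using fun z hz => (hlt z (hs hz)).le⟩
  change _ ∧ (∃ z, IsGreatest _ z ∧ _) ↔ _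
  rw [Finset.card_insert_of_notMem hys, and_comm]
  refine and_congr_left' ⟨?_, fun h => ⟨y, hgreatest, by rwa [Finset.erase_insert hys]⟩⟩
  rintro ⟨z, hz, hzs⟩
  rwa [hz.unique hgreatest, Finset.erase_insert hys] at hzs

end Existence

theorem mainTheorem4 (n : ℕ) (hn : 2 ≤ n) (m r : ℕ) (hmr : IsAdmissiblePair n m r) :
    ∃ (L : FirstOrder.Language.{0, 0}) (T : L.Theory),
      T.IsComplete ∧ aar T = (n : ℕ∞) ∧ HasAarDegree T m r := by
  classical
  let ar : Fin m ⊕ ℕ → ℕ := Sum.elim (fun _ => r) fun _ => n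
  obtain ⟨_, hgen⟩ := HypergraphFamily.exists_isGeneric ar
  let L := hypergraphLanguage ar
  let T := L.completeTheory ℕ
  let Φ : Finset (L.Formula (Fin r)) :=
    Finset.univ.image fun j : Fin m => (edgeSymbol ar (.inl j)).formula Term.var
  have hΦ : WitnessesAlmostAry T n Φ :=
    hgen.hasExtensionProperty.witnessesAlmostAry hn fun k R hk e => by
      obtain ⟨j | _, rfl⟩ := R
      · exact ⟨_, Finset.mem_image_of_mem _ (Finset.mem_univ j), e, rfl⟩
      · exact absurd hk (lt_irrefl n)
  have haar : aar T = n := aar_eq (one_le_two.trans hn) ⟨r, Φ, hΦ⟩ fun k hk =>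
    hgen.not_almostAry (Set.infinite_of_injective_forall_mem Sum.inr_injective fun _ => rfl) hk
  have hΦm : Φ.card ≤ m := Finset.card_image_le.trans_eq (Finset.card_fin m)
  refine ⟨L, T, completeTheory.isComplete L ℕ, haar,
    hasAarDegree_of_witnessesAlmostAry haar hΦ hΦm (fun hΨ => ?_) fun hΨ => ?_⟩
  all_goals obtain ⟨rfl, rfl⟩ | ⟨hm, hr⟩ := hmr
  · exact Nat.zero_le _
  · exact hgen.arity_le_of_witnessesAlmostAry (i := .inl ⟨0, Nat.pos_of_ne_zero hm⟩) hr hΨ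
  · exact Nat.zero_le _
  · simpa using hgen.card_le_card_of_witnessesAlmostAry
      (I := Finset.univ.map Function.Embedding.inl) (by simp [ar]) hr hΨ
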